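/- Let $I=[0,1]$. A continuous map $f\colon I\to I$ is *open* if $f(U)$ is open in $I$ for every open $U\subset I$. For $n\ge 2$, let $F_n\colon I\to I$ denote a continuous open map with exactly $n-1$ critical points, that is, there are points $0=c_0<c_1<\dots<c_n=1$ such that $F_n$ is one-to-one on each $[c_i,c_{i+1}]$ and the points of $I$ that have no neighbourhood in $I$ on which $F_n$ is (weakly) monotone are exactly $c_1,\dots,c_{n-1}$. For a set-valued function $F\colon I\to 2^I$, a *$k$-orbit* of $F$ is a tuple $(x_1,\dots,x_k)\in I^k$ with $x_{i+1}\in F(x_i)$ for $1\le i<k$. A set $S$ of $k$-orbits is *$(k,\varepsilon)$-separated* if for any two distinct $(x_i),(y_i)\in S$ there is an $i\in\{1,\dots,k\}$ with $|x_i-y_i|>\varepsilon$; let $s_{k,\varepsilon}(F)$ be the largest cardinality of a $(k,\varepsilon)$-separated set. The *entropy* of $F$ is $$\mathrm{Ent}(F)=\lim_{\varepsilon\to 0^+}\ \limsup_{k\to\infty}\frac1k\log s_{k,\varepsilon}(F).$$ **Theorem.** Let $n,m\ge 2$, and let $F_n,F_m\colon I\to I$ be continuous open maps with exactly $n-1$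 and $m-1$ critical points, respectively. Suppose that $F_n$ and $F_m$ strongly commute, i.e. $F_n\circ F_m^{-1}=F_m^{-1}\circ F_n$ as set-valued functions, which means $F_n(F_m^{-1}(\{x\}))=F_m^{-1}(\{F_n(x)\})$ for every $x\in I$. Then $$\mathrm{Ent}(F_n\circ F_m^{-1})=\max\{\log n,\log m\}.$$ -/

import Mathlib

open Set Filter Topology

/-! Set-valued functions from `X` to `Y` are represented by functions `X → Set Y`. -/

/-- A single-valued function, seen as a set-valued function. -/
def SetValued.ofMap {X Y : Type*} (f : X → Y) : X → Set Y := fun x => {f x}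

/-- The inverse `f⁻¹` of a single-valued function, as a set-valued function. -/
def SetValued.inv {X Y : Type*} (f : X → Y) : Y → Set X := fun y => f ⁻¹' {y}

/-- The composition `G ∘ F` of set-valued functions. -/
def SetValued.comp {X Y Z : Type*} (G : Y → Set Z) (F : X → Set Y) : X → Set Z :=
  fun x => ⋃ y ∈ F x, G y

/-- `Orb_n(F)`: the set of `n`-orbits of a set-valued function `F`. -/
def SetValued.orbits {X : Type*} (F : X → Set X) (n : ℕ) : Set (Fin n → X) :=
  {x | ∀ (i : ℕ) (h : i + 1 < n), x ⟨i + 1, h⟩ ∈ F (x ⟨i, Nat.lt_of_succ_lt h⟩)}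

/-- `S` is an `(n, ε)`-separated set of `n`-orbits of `F`. -/
def SetValued.IsSeparated {X : Type*} [MetricSpace X] (F : X → Set X) (n : ℕ) (ε : ℝ)
    (S : Set (Fin n → X)) : Prop :=
  S ⊆ SetValued.orbits F n ∧ S.Pairwise fun x y => ∃ i, ε < dist (x i) (y i)

/-- `s_{n,ε}(F)`: the largest cardinality of an `(n, ε)`-separated set. -/
noncomputable def SetValued.maxSeparated {X : Type*} [MetricSpace X] (F : X → Set X) (n : ℕ)
    (ε : ℝ) : ℕ∞ :=
  ⨆ (S : Set (Fin n → X)) (_ : SetValued.IsSeparated F n ε S), S.encard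

/-- The growth rate `limsup_n (1/n) log s_{n,ε}(F)`. -/
noncomputable def SetValued.entropyAt {X : Type*} [MetricSpace X] (F : X → Set X) (ε : ℝ) :
    EReal :=
  limsup (fun n : ℕ => ENNReal.log (SetValued.maxSeparated F n ε : ENNReal) / (n : EReal)) atTop

/-- The entropy `Ent(F) = lim_{ε → 0} limsup_n (1/n) log s_{n,ε}(F)`. The growth rate increases as
`ε` decreases to `0`, so the limit is a supremum; see `SetValued.tendsto_entropyAt`. -/
noncomputable def SetValued.entropy {X : Type*} [MetricSpace X] (F : X → Set X) : EReal :=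
  ⨆ (ε : ℝ) (_ : 0 < ε), SetValued.entropyAt F ε

theorem SetValued.entropyAt_antitone {X : Type*} [MetricSpace X] (F : X → Set X) :
    Antitone (SetValued.entropyAt F) := by
  intro a b hab
  refine limsup_le_limsup (Eventually.of_forall fun n => ?_)
  refine EReal.div_le_div_right_of_nonneg (by exact_mod_cast Nat.zero_le n) ?_
  refine ENNReal.log_monotone (ENat.toENNReal_le.2 ?_)
  refine iSup₂_le fun S hS => ?_
  refine le_iSup₂_of_le S ⟨hS.1, fun x hx y hy hxy => ?_⟩ le_rfl
  obtain ⟨i, hi⟩ := hS.2 hx hy hxy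
  exact ⟨i, lt_of_le_of_lt hab hi⟩

theorem SetValued.tendsto_entropyAt {X : Type*} [MetricSpace X] (F : X → Set X) :
    Tendsto (SetValued.entropyAt F) (𝓝[>] 0) (𝓝 (SetValued.entropy F)) := by
  have h := (SetValued.entropyAt_antitone F).tendsto_nhdsGT (0 : ℝ)
  rwa [sSup_image] at h

/-- A critical point of an interval map: a point such that the map is not monotone on any of
its neighbourhoods in `[0, 1]`. -/
def IsCriticalPoint (f : unitInterval → unitInterval) (x : unitInterval) : Prop :=
  ¬ ∃ U ∈ 𝓝 x, MonotoneOn f U ∨ AntitoneOn f U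

/-- `f` is an open (continuous, piecewise monotone) interval map with exactly `n - 1` critical
points: for some `0 = c₀ < c₁ < ⋯ < cₙ = 1`, the map `f` is one-to-one on every
`[cᵢ, cᵢ₊₁]`, and its critical points are exactly `c₁, …, cₙ₋₁`. -/
structure IsOpenIntervalMap (n : ℕ) (f : unitInterval → unitInterval) : Prop where
  continuous : Continuous f
  isOpenMap : IsOpenMap f
  piecewise_monotone : ∃ c : Fin (n + 1) → unitInterval,
    StrictMono c ∧ c 0 = 0 ∧ c (Fin.last n) = 1 ∧
    (∀ i : Fin n, InjOn f (Icc (c i.castSucc) (c i.succ))) ∧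
    {x | IsCriticalPoint f x} = c '' Ioo 0 (Fin.last n)

/-! ### Open interval maps have full laps -/

/-! Write `f` for `F_m` and `g` for `F_n`. Strong commutation says that `f` and `g` commute and that
`f y = g x` forces a common lift `v` with `f v = x`, `g v = y`. Filling in lifts in a triangular
array shows that every `k`-orbit of `g ∘ f⁻¹` has the form `g^[i] (f^[k-1-i] z)`, `i < k`, for one
point `z` (`StronglyCommute.exists_common_lift`).

Upper bound: each coordinate map is at most `max n m ^ (k-1)` to one. If two orbits are
`ε`-separated at `i`, the `i`-th coordinate map hits a fixed finite net strictly between their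
parameters. So the parameters are separated by a set of at most `k * max n m ^ (k-1) * C` points
(`encard_le_of_separated`).

Lower bound: openness makes every lap full, so `f^[p]` has `m ^ p` full branches. Every second one
gives `K ≥ m ^ p / 2` uniformly separated right inverses; choosing among them freely once per `p`
steps yields growth at least `log m - log 2 / p` (`StronglyCommute.pow_le_maxSeparated`). Reversing
orbits exchanges `f` and `g`, which gives `log n`. -/

theorem IsOpenMap.eq_zero_of_isMinOn {f : unitInterval → unitInterval} (hf : IsOpenMap f)
    {U : Set unitInterval} (hU : IsOpen U) {x : unitInterval} (hx : x ∈ U)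
    (h : IsMinOn f U x) : f x = 0 := by
  by_contra hne
  have hpos : 0 < f x := unitInterval.pos_iff_ne_zero.2 hne
  obtain ⟨l, hl, hsub⟩ := exists_Ioc_subset_of_mem_nhds
    ((hf U hU).mem_nhds (mem_image_of_mem f hx)) ⟨0, hpos⟩
  obtain ⟨v, hlv, hvx⟩ := exists_between hl
  obtain ⟨u, hu, rfl⟩ := hsub ⟨hlv, hvx.le⟩
  exact absurd (h hu) (not_le.2 hvx)

theorem IsOpenMap.eq_one_of_isMaxOn {f : unitInterval → unitInterval} (hf : IsOpenMap f)
    {U : Set unitInterval} (hU : IsOpen U) {x : unitInterval} (hx : x ∈ U)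
    (h : IsMaxOn f U x) : f x = 1 := by
  by_contra hne
  have hpos : f x < 1 := unitInterval.lt_one_iff_ne_one.2 hne
  obtain ⟨l, hl, hsub⟩ := exists_Ico_subset_of_mem_nhds
    ((hf U hU).mem_nhds (mem_image_of_mem f hx)) ⟨1, hpos⟩
  obtain ⟨v, hxv, hvl⟩ := exists_between hl
  obtain ⟨u, hu, rfl⟩ := hsub ⟨hxv.le, hvl⟩
  exact absurd (h hu) (not_le.2 hxv)

theorem IsOpenMap.extreme_at_zero {f : unitInterval → unitInterval} (hc : Continuous f)
    (hf : IsOpenMap f) {b : unitInterval} (hb : 0 < b) (hinj : InjOn f (Icc 0 b)) :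
    f 0 = 0 ∨ f 0 = 1 := by
  rcases hc.continuousOn.strictMonoOn_of_injOn_Icc' hb.le hinj with h | h
  · exact .inl (hf.eq_zero_of_isMinOn isOpen_Iio hb fun y (hy : y < b) =>
      h.monotoneOn ⟨le_rfl, hb.le⟩ ⟨bot_le, hy.le⟩ bot_le)
  · exact .inr (hf.eq_one_of_isMaxOn isOpen_Iio hb fun y (hy : y < b) =>
      h.antitoneOn ⟨le_rfl, hb.le⟩ ⟨bot_le, hy.le⟩ bot_le)

theorem IsOpenMap.extreme_at_one {f : unitInterval → unitInterval} (hc : Continuous f)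
    (hf : IsOpenMap f) {a : unitInterval} (ha : a < 1) (hinj : InjOn f (Icc a 1)) :
    f 1 = 0 ∨ f 1 = 1 := by
  rcases hc.continuousOn.strictMonoOn_of_injOn_Icc' ha.le hinj with h | h
  · exact .inr (hf.eq_one_of_isMaxOn isOpen_Ioi ha fun y (hy : a < y) =>
      h.monotoneOn ⟨hy.le, le_top⟩ ⟨ha.le, le_rfl⟩ le_top)
  · exact .inl (hf.eq_zero_of_isMinOn isOpen_Ioi ha fun y (hy : a < y) =>
      h.antitoneOn ⟨hy.le, le_top⟩ ⟨ha.le, le_rfl⟩ le_top)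

/-- The laps on the two sides of a critical point have opposite directions, since otherwise they
would glue to a monotone map; so the point is a local extremum, and openness forces its value. -/
theorem IsOpenMap.extreme_at_critical {f : unitInterval → unitInterval} (hc : Continuous f)
    (hf : IsOpenMap f) {a x b : unitInterval} (hax : a < x) (hxb : x < b)
    (hl : InjOn f (Icc a x)) (hr : InjOn f (Icc x b)) (hx : IsCriticalPoint f x) :
    f x = 0 ∨ f x = 1 := by
  have hgl : IsGreatest (Icc a x) x := isGreatest_Icc hax.le
  have hlr : IsLeast (Icc x b) x := isLeast_Icc hxb.le
  have hun : Icc a x ∪ Icc x b = Icc a b := Icc_union_Icc_eq_Icc hax.le hxb.le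
  rcases hc.continuousOn.strictMonoOn_of_injOn_Icc' hax.le hl with h | h <;>
  rcases hc.continuousOn.strictMonoOn_of_injOn_Icc' hxb.le hr with h' | h'
  · exact absurd ⟨Icc a b, Icc_mem_nhds hax hxb,
      .inl (hun ▸ h.monotoneOn.union_right h'.monotoneOn hgl hlr)⟩ hx
  · refine .inr (hf.eq_one_of_isMaxOn (isOpen_Ioo (a := a) (b := b)) ⟨hax, hxb⟩ fun y hy => ?_)
    rcases le_total y x with hyx | hyx
    · exact h.monotoneOn ⟨hy.1.le, hyx⟩ hgl.1 hyx
    · exact h'.antitoneOn hlr.1 ⟨hyx, hy.2.le⟩ hyx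
  · refine .inl (hf.eq_zero_of_isMinOn (isOpen_Ioo (a := a) (b := b)) ⟨hax, hxb⟩ fun y hy => ?_)
    rcases le_total y x with hyx | hyx
    · exact h.antitoneOn ⟨hy.1.le, hyx⟩ hgl.1 hyx
    · exact h'.monotoneOn hlr.1 ⟨hyx, hy.2.le⟩ hyx
  · exact absurd ⟨Icc a b, Icc_mem_nhds hax hxb,
      .inr (hun ▸ h.antitoneOn.union_right h'.antitoneOn hgl hlr)⟩ hx

/-- `f` maps each of `M` nonoverlapping nondegenerate intervals bijectively onto `[0, 1]`. -/
def HasFullBranches (M : ℕ) (f : unitInterval → unitInterval) : Prop :=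
  ∃ a b : Fin M → unitInterval, (∀ i, a i < b i) ∧ (∀ i, InjOn f (Icc (a i) (b i))) ∧
    (∀ i, SurjOn f (Icc (a i) (b i)) univ) ∧
    Pairwise fun i j => Disjoint (Ioo (a i) (b i)) (Ioo (a j) (b j))

/-- Lap endpoints map into `{0, 1}`, injectivity makes the two values differ, and the intermediate
value theorem fills the lap. -/
theorem IsOpenIntervalMap.hasFullBranches {n : ℕ} {f : unitInterval → unitInterval}
    (hf : IsOpenIntervalMap n f) : HasFullBranches n f := by
  obtain ⟨hc, ho, c, hmono, h0, h1, hinj, hcrit⟩ := hf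
  have hlt : ∀ i : Fin n, c i.castSucc < c i.succ := fun i => hmono i.castSucc_lt_succ
  have hext : ∀ i, f (c i) = 0 ∨ f (c i) = 1 := by
    intro i
    rcases n with _ | n
    · exact absurd (h0.symm.trans h1) zero_ne_one
    rcases eq_or_ne i 0 with rfl | hi0
    · rw [h0]
      have := hinj 0
      have h := hlt 0
      rw [Fin.castSucc_zero, h0] at this h
      exact ho.extreme_at_zero hc h this
    rcases eq_or_ne i (Fin.last _) with rfl | hi1
    · rw [h1]
      have := hinj (Fin.last n)
      have h := hlt (Fin.last n)
      rw [Fin.succ_last, h1] at this h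
      exact ho.extreme_at_one hc h this
    obtain ⟨j, hj⟩ := Fin.exists_succ_eq_of_ne_zero hi0
    obtain ⟨k, hk⟩ := Fin.exists_castSucc_eq.2 hi1
    have hx : IsCriticalPoint f (c i) := by
      have : c i ∈ {x | IsCriticalPoint f x} :=
        hcrit ▸ mem_image_of_mem c ⟨Fin.pos_iff_ne_zero.2 hi0, Fin.lt_last_iff_ne_last.2 hi1⟩
      exact this
    have hj1 := hinj j
    have hj2 := hlt j
    have hk1 := hinj k
    have hk2 := hlt k
    rw [hj] at hj1 hj2
    rw [hk] at hk1 hk2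
    exact ho.extreme_at_critical hc hj2 hk2 hj1 hk1 hx
  refine ⟨fun i => c i.castSucc, fun i => c i.succ, hlt, hinj, fun i => ?_, fun i j hij => ?_⟩
  · have hne : f (c i.castSucc) ≠ f (c i.succ) := fun h =>
      (hlt i).ne (hinj i ⟨le_rfl, (hlt i).le⟩ ⟨(hlt i).le, le_rfl⟩ h)
    rcases hext i.castSucc with h | h <;> rcases hext i.succ with h' | h'
    · exact absurd (h.trans h'.symm) hne
    · intro y _
      exact intermediate_value_Icc (hlt i).le hc.continuousOn
        ⟨h.symm ▸ bot_le, h'.symm ▸ le_top⟩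
    · intro y _
      exact intermediate_value_Icc' (hlt i).le hc.continuousOn
        ⟨h'.symm ▸ bot_le, h.symm ▸ le_top⟩
    · exact absurd (h.trans h'.symm) hne
  · wlog h : i < j generalizing i j
    · exact (this j i hij.symm (lt_of_le_of_ne (not_lt.1 h) hij.symm)).symm
    refine Set.disjoint_left.2 fun x hx hy => ?_
    have : c i.succ ≤ c j.castSucc := hmono.monotone (by
      rw [Fin.le_def]; simpa using h)
    exact absurd (hx.2.trans_le this) (not_lt.2 hy.1.le)

/-- Every point of `[0, 1]` has at most `n` preimages under an open map with `n` laps. -/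
theorem IsOpenIntervalMap.encard_fiber_le {n : ℕ} {f : unitInterval → unitInterval}
    (hf : IsOpenIntervalMap n f) (y : unitInterval) : (f ⁻¹' {y}).encard ≤ n := by
  obtain ⟨hc, ho, c, hmono, h0, h1, hinj, hcrit⟩ := hf
  have hcover : ∀ x, ∃ i : Fin n, x ∈ Icc (c i.castSucc) (c i.succ) := by
    intro x
    by_contra! hx
    have : ∀ i : Fin (n + 1), c i ≤ x := by
      intro i
      induction i using Fin.induction with
      | zero => exact h0 ▸ bot_le
      | succ i ih => exact le_of_not_ge fun h => hx i ⟨ih, h⟩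
    rcases n with _ | n
    · exact absurd (h0.symm.trans h1) zero_ne_one
    refine hx (Fin.last n) ⟨this _, ?_⟩
    rw [Fin.succ_last, h1]
    exact le_top
  choose lap hlap using hcover
  calc (f ⁻¹' {y}).encard ≤ (univ : Set (Fin n)).encard := by
        refine encard_le_encard_of_injOn (f := lap) (fun _ _ => mem_univ _) fun x hx x' hx' h => ?_
        refine hinj (lap x) (hlap x) (h ▸ hlap x') ?_
        exact hx.trans hx'.symm
    _ = n := by simp

/-! ### Full branches of composites -/

theorem HasFullBranches.comp {M N : ℕ} {f g : unitInterval → unitInterval} (hc : Continuous f)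
    (hf : HasFullBranches M f) (hg : HasFullBranches N g) : HasFullBranches (M * N) (g ∘ f) := by
  obtain ⟨a, b, hab, hinj, hsurj, hdisj⟩ := hf
  obtain ⟨a', b', hab', hinj', hsurj', hdisj'⟩ := hg
  -- Pull the `j`-th branch of `g` back through the `i`-th branch of `f`. The clause on open
  -- intervals is what makes pullbacks inside one branch of `f` disjoint.
  have key : ∀ i j, ∃ u v, u < v ∧ a i ≤ u ∧ v ≤ b i ∧ f '' Icc u v = Icc (a' j) (b' j) ∧
      MapsTo f (Ioo u v) (Ioo (a' j) (b' j)) := by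
    intro i j
    obtain ⟨p, hp, hpa⟩ := hsurj i (mem_univ (a' j))
    obtain ⟨q, hq, hqb⟩ := hsurj i (mem_univ (b' j))
    rcases hc.continuousOn.strictMonoOn_of_injOn_Icc' (hab i).le (hinj i) with h | h
    · have hpq : p < q := (h.lt_iff_lt hp hq).1 (by rw [hpa, hqb]; exact hab' j)
      have hs : Icc p q ⊆ Icc (a i) (b i) := Icc_subset_Icc hp.1 hq.2
      refine ⟨p, q, hpq, hp.1, hq.2, Subset.antisymm ?_ ?_, fun x hx => ?_⟩
      · rintro _ ⟨x, hx, rfl⟩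
        exact ⟨hpa ▸ h.monotoneOn hp (hs hx) hx.1, hqb ▸ h.monotoneOn (hs hx) hq hx.2⟩
      · rw [← hpa, ← hqb]
        exact intermediate_value_Icc hpq.le hc.continuousOn
      · have hx' := hs (Ioo_subset_Icc_self hx)
        exact ⟨hpa ▸ h hp hx' hx.1, hqb ▸ h hx' hq hx.2⟩
    · have hpq : q < p := (h.lt_iff_gt hp hq).1 (by rw [hpa, hqb]; exact hab' j)
      have hs : Icc q p ⊆ Icc (a i) (b i) := Icc_subset_Icc hq.1 hp.2
      refine ⟨q, p, hpq, hq.1, hp.2, Subset.antisymm ?_ ?_, fun x hx => ?_⟩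
      · rintro _ ⟨x, hx, rfl⟩
        exact ⟨hpa ▸ h.antitoneOn (hs hx) hp hx.2, hqb ▸ h.antitoneOn hq (hs hx) hx.1⟩
      · rw [← hpa, ← hqb]
        exact intermediate_value_Icc' hpq.le hc.continuousOn
      · have hx' := hs (Ioo_subset_Icc_self hx)
        exact ⟨hpa ▸ h hx' hp hx.2, hqb ▸ h hq hx' hx.1⟩
  choose u v huv hau hvb himg hmaps using key
  let e : Fin (M * N) ≃ Fin M × Fin N := finProdFinEquiv.symm
  refine ⟨fun k => u (e k).1 (e k).2, fun k => v (e k).1 (e k).2, fun k => huv _ _, fun k => ?_,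
    fun k => ?_, fun k l hkl => ?_⟩
  · exact (hinj' (e k).2).comp ((hinj (e k).1).mono (Icc_subset_Icc (hau _ _) (hvb _ _)))
      (mapsTo_iff_image_subset.2 (himg _ _).subset)
  · rw [SurjOn, image_comp, himg]
    exact hsurj' _
  · have hne : e k ≠ e l := e.injective.ne hkl
    refine Set.disjoint_left.2 fun x hx hy => ?_
    by_cases h1 : (e k).1 = (e l).1
    · have h2 : (e k).2 ≠ (e l).2 := fun h2 => hne (Prod.ext h1 h2)
      exact Set.disjoint_left.1 (hdisj' h2) (hmaps _ _ hx) (hmaps _ _ hy)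
    · exact Set.disjoint_left.1 (hdisj h1) (Ioo_subset_Ioo (hau _ _) (hvb _ _) hx)
        (Ioo_subset_Ioo (hau _ _) (hvb _ _) hy)

theorem HasFullBranches.id : HasFullBranches 1 id :=
  ⟨fun _ => 0, fun _ => 1, fun _ => zero_lt_one, fun _ => injOn_id _,
    fun _ y _ => ⟨y, ⟨bot_le, le_top⟩, rfl⟩, fun i j h => absurd (Subsingleton.elim i j) h⟩

theorem HasFullBranches.iterate {M : ℕ} {f : unitInterval → unitInterval} (hc : Continuous f)
    (hf : HasFullBranches M f) (p : ℕ) : HasFullBranches (M ^ p) f^[p] := by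
  induction p with
  | zero => simpa using HasFullBranches.id
  | succ p ih =>
    rw [pow_succ, Function.iterate_succ']
    exact ih.comp (hc.iterate p) hf

/-- Choosing every second full branch gives uniformly separated right inverses. -/
theorem HasFullBranches.exists_separated_rightInverse {M : ℕ} {f : unitInterval → unitInterval}
    (hf : HasFullBranches M f) : ∃ (K : ℕ) (ε : ℝ) (r : Fin K → unitInterval → unitInterval),
      M ≤ 2 * K ∧ 0 < ε ∧ (∀ i y, f (r i y) = y) ∧
      ∀ i j, i ≠ j → ∀ y z, ε < dist (r i y) (r j z) := by
  obtain ⟨a, b, hab, hinj, hsurj, hdisj⟩ := hf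
  obtain ⟨ε, hε0, hε⟩ : ∃ ε : ℝ, 0 < ε ∧ ∀ i, ε < (b i : ℝ) - a i := by
    have : ∀ᶠ ε : ℝ in 𝓝[>] 0, 0 < ε ∧ ∀ i, ε < (b i : ℝ) - a i :=
      (eventually_mem_nhdsWithin).and (eventually_all.2 fun i =>
        by
        filter_upwards [Ioo_mem_nhdsGT (sub_pos.2 (show (a i : ℝ) < b i from hab i))] with ε h
        exact h.2)
    exact this.exists
  have hainj : Function.Injective a := by
    intro i j hij
    by_contra hne
    obtain ⟨x, hx1, hx2⟩ := exists_between (lt_min (hab i) (hij ▸ hab j : a i < b j))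
    exact Set.disjoint_left.1 (hdisj hne) ⟨hx1, hx2.trans_le (min_le_left _ _)⟩
      ⟨hij ▸ hx1, hx2.trans_le (min_le_right _ _)⟩
  have hle : ∀ i j, a i < a j → b i ≤ a j := by
    intro i j hij
    by_contra! h
    obtain ⟨x, hx1, hx2⟩ := exists_between (lt_min h (hab j))
    exact Set.disjoint_left.1 (hdisj (fun h => hij.ne (congrArg a h)))
      ⟨hij.trans hx1, hx2.trans_le (min_le_left _ _)⟩ ⟨hx1, hx2.trans_le (min_le_right _ _)⟩
  have hσ : StrictMono (a ∘ Tuple.sort a) :=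
    (Tuple.monotone_sort a).strictMono_of_injective (hainj.comp (Tuple.sort a).injective)
  set σ := Tuple.sort a
  choose s hs hfs using fun i y => hsurj i (mem_univ y)
  let ι : Fin ((M + 1) / 2) → Fin M := fun i => ⟨2 * i, by omega⟩
  have hsep : ∀ i j, i < j → ∀ y z, ε < dist (s (σ (ι i)) y) (s (σ (ι j)) z) := by
    intro i j hij y z
    have hij' : (i : ℕ) < j := hij
    -- The skipped branch lies between the two chosen ones and is longer than `ε`.
    let k : Fin M := ⟨2 * i + 1, by omega⟩
    have h1 : b (σ (ι i)) ≤ a (σ k) := hle _ _ (hσ (Fin.lt_def.2 (by simp [ι, k])))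
    have h2 : b (σ k) ≤ a (σ (ι j)) := hle _ _ (hσ (Fin.lt_def.2 (by simp [ι, k]; omega)))
    have h3 : (s (σ (ι i)) y : ℝ) ≤ a (σ k) := (hs (σ (ι i)) y).2.trans h1
    have h4 : (b (σ k) : ℝ) ≤ s (σ (ι j)) z := h2.trans (hs (σ (ι j)) z).1
    have h5 := hε (σ k)
    rw [Subtype.dist_eq, Real.dist_eq, abs_sub_comm]
    exact lt_of_lt_of_le (by linarith) (le_abs_self _)
  refine ⟨(M + 1) / 2, ε, fun i => s (σ (ι i)), by omega, hε0, fun i y => hfs _ _,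
    fun i j hij y z => ?_⟩
  rcases lt_or_gt_of_ne hij with h | h
  · exact hsep i j h y z
  · rw [dist_comm]
    exact hsep j i h z y

/-! ### Strongly commuting maps -/

/-- `f` and `g` commute, and any two points `x`, `y` with `f y = g x` have a common lift. -/
def StronglyCommute {X : Type*} (f g : X → X) : Prop :=
  Function.Commute f g ∧ ∀ x y, f y = g x → ∃ v, f v = x ∧ g v = y

theorem SetValued.mem_comp_ofMap_inv {X : Type*} {f g : X → X} {x y : X} :
    y ∈ SetValued.comp (SetValued.ofMap g) (SetValued.inv f) x ↔ ∃ v, f v = x ∧ g v = y := by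
  simp [SetValued.comp, SetValued.ofMap, SetValued.inv, eq_comm]

theorem StronglyCommute.of_comp_eq {X : Type*} {f g : X → X}
    (h : SetValued.comp (SetValued.ofMap g) (SetValued.inv f) =
      SetValued.comp (SetValued.inv f) (SetValued.ofMap g)) : StronglyCommute f g := by
  have key : ∀ x y, (∃ v, f v = x ∧ g v = y) ↔ f y = g x := by
    intro x y
    rw [← SetValued.mem_comp_ofMap_inv, h]
    simp [SetValued.comp, SetValued.ofMap, SetValued.inv]
  exact ⟨fun x => (key _ _).1 ⟨x, rfl, rfl⟩, fun x y => (key x y).2⟩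

theorem StronglyCommute.symm {X : Type*} {f g : X → X} (h : StronglyCommute f g) :
    StronglyCommute g f :=
  ⟨h.1.symm, fun x y hxy => (h.2 y x hxy.symm).imp fun _ hv => hv.symm⟩

theorem StronglyCommute.iterate_right {X : Type*} {f g : X → X} (h : StronglyCommute f g)
    (p : ℕ) : StronglyCommute f g^[p] := by
  refine ⟨h.1.iterate_right p, ?_⟩
  induction p with
  | zero => exact fun x y hxy => ⟨y, hxy, rfl⟩
  | succ p ih =>
    intro x y hxy
    rw [Function.iterate_succ_apply'] at hxy
    obtain ⟨v, hv, hvy⟩ := h.2 _ _ hxy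
    obtain ⟨u, hu, huv⟩ := ih _ _ hv
    exact ⟨u, hu, by rw [Function.iterate_succ_apply', huv, hvy]⟩

theorem StronglyCommute.iterate {X : Type*} {f g : X → X} (h : StronglyCommute f g) (p : ℕ) :
    StronglyCommute f^[p] g^[p] :=
  (h.iterate_right p).symm.iterate_right p |>.symm

/-- Orbits of `g ∘ f⁻¹` are parametrized by single points. -/
theorem StronglyCommute.exists_common_lift {X : Type*} {f g : X → X} (h : StronglyCommute f g)
    (j : ℕ) (x : ℕ → X) (hx : ∀ t < j, f (x (t + 1)) = g (x t)) :
    ∃ z, ∀ t ≤ j, x t = g^[t] (f^[j - t] z) := by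
  induction j generalizing x with
  | zero => exact ⟨x 0, fun t ht => by obtain rfl := Nat.le_zero.1 ht; rfl⟩
  | succ j ih =>
    have hy : ∀ t, ∃ y, t ≤ j → f y = x t ∧ g y = x (t + 1) := fun t => by
      by_cases ht : t ≤ j
      · exact (h.2 _ _ (hx t (Nat.lt_succ_of_le ht))).imp fun _ hv _ => hv
      · exact ⟨x t, fun h => absurd h ht⟩
    choose y hy using hy
    -- The lifts form a sequence shorter by one with the same relation: `f (y (t + 1)) = x (t + 1) =
    -- g (y t)`.
    obtain ⟨z, hz⟩ := ih y fun t ht => (hy (t + 1) ht).1.trans (hy t ht.le).2.symm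
    refine ⟨z, fun t ht => ?_⟩
    rcases Nat.le_succ_iff.1 ht with ht | rfl
    · rw [← (hy t ht).1, hz t ht, (h.1.iterate_right t).eq, ← Function.iterate_succ_apply' f,
        Nat.succ_sub ht]
    · rw [← (hy j le_rfl).2, hz j le_rfl]
      simp [Function.iterate_succ_apply']

theorem StronglyCommute.mem_orbits {X : Type*} {f g : X → X} (h : StronglyCommute f g)
    (k : ℕ) (z : X) : (fun i : Fin k => g^[i] (f^[k - 1 - i] z)) ∈
      SetValued.orbits (SetValued.comp (SetValued.ofMap g) (SetValued.inv f)) k := by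
  intro i hi
  refine SetValued.mem_comp_ofMap_inv.2 ⟨g^[i] (f^[k - 1 - (i + 1)] z), ?_, ?_⟩
  · rw [(h.1.iterate_right i).eq, ← Function.iterate_succ_apply' f]
    congr 2
    have : (⟨i, Nat.lt_of_succ_lt hi⟩ : Fin k).val = i := rfl
    omega
  · rw [← Function.iterate_succ_apply' g]

theorem StronglyCommute.exists_lift_of_mem_orbits {X : Type*} {f g : X → X}
    (h : StronglyCommute f g) {k : ℕ} (hk : 0 < k) {x : Fin k → X}
    (hx : x ∈ SetValued.orbits (SetValued.comp (SetValued.ofMap g) (SetValued.inv f)) k) :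
    ∃ z, ∀ i : Fin k, x i = g^[i] (f^[k - 1 - i] z) := by
  obtain ⟨z, hz⟩ := h.exists_common_lift (k - 1)
    (fun t => if ht : t < k then x ⟨t, ht⟩ else x ⟨0, hk⟩) fun t ht => by
      have h1 : t + 1 < k := by omega
      obtain ⟨v, hv, hv'⟩ := SetValued.mem_comp_ofMap_inv.1 (hx t h1)
      rw [dif_pos h1, dif_pos (Nat.lt_of_succ_lt h1), ← hv, ← hv', h.1.eq]
  refine ⟨z, fun i => ?_⟩
  rw [← hz i (by omega), dif_pos i.2]

/-! ### Reversing orbits -/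

/-- A witness `v` for a step from `g v` to `f v` also witnesses the reverse step. -/
theorem SetValued.maxSeparated_reverse_le {X : Type*} [MetricSpace X] (f g : X → X) (k : ℕ)
    (ε : ℝ) : SetValued.maxSeparated (SetValued.comp (SetValued.ofMap f) (SetValued.inv g)) k ε ≤
      SetValued.maxSeparated (SetValued.comp (SetValued.ofMap g) (SetValued.inv f)) k ε := by
  refine iSup₂_le fun S hS => ?_
  have hinj : Function.Injective fun (x : Fin k → X) (i : Fin k) => x i.rev := fun x y hxy =>
    funext fun i => by simpa using congrFun hxy i.rev
  rw [← hinj.encard_image S]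
  refine le_iSup₂_of_le _ ⟨?_, ?_⟩ le_rfl
  · rintro _ ⟨x, hx, rfl⟩ i hi
    obtain ⟨v, hv, hv'⟩ := SetValued.mem_comp_ofMap_inv.1 (hS.1 hx (k - 1 - (i + 1)) (by omega))
    refine SetValued.mem_comp_ofMap_inv.2 ⟨v, hv'.trans ?_, hv.trans ?_⟩ <;>
    · refine congrArg x (Fin.ext ?_)
      simp only [Fin.val_rev]
      omega
  · rintro _ ⟨x, hx, rfl⟩ _ ⟨y, hy, rfl⟩ hxy
    obtain ⟨i, hi⟩ := hS.2 hx hy fun h => hxy (by rw [h])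
    exact ⟨i.rev, by simpa using hi⟩

theorem SetValued.entropy_reverse {X : Type*} [MetricSpace X] (f g : X → X) :
    SetValued.entropy (SetValued.comp (SetValued.ofMap f) (SetValued.inv g)) =
      SetValued.entropy (SetValued.comp (SetValued.ofMap g) (SetValued.inv f)) := by
  have : SetValued.maxSeparated (SetValued.comp (SetValued.ofMap f) (SetValued.inv g)) =
      SetValued.maxSeparated (SetValued.comp (SetValued.ofMap g) (SetValued.inv f)) :=
    funext₂ fun k ε => le_antisymm (maxSeparated_reverse_le f g k ε)
      (maxSeparated_reverse_le g f k ε)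
  simp only [SetValued.entropy, SetValued.entropyAt, this]

/-! ### Growth rates -/

theorem ENNReal.log_toENNReal_natCast {a : ℕ} (ha : a ≠ 0) :
    ENNReal.log (((a : ℕ∞) : ENNReal)) = (Real.log a : EReal) := by
  rw [ENat.toENNReal_coe, ENNReal.log_pos_real (by exact_mod_cast ha) (ENNReal.natCast_ne_top a),
    ENNReal.toReal_natCast]

theorem SetValued.entropyAt_le_log {X : Type*} [MetricSpace X] {F : X → Set X} {ε : ℝ}
    {N C : ℕ} (hN : 0 < N)
    (h : ∀ k, 0 < k → SetValued.maxSeparated F k ε ≤ ((k * (N ^ (k - 1) * C) + 1 : ℕ) : ℕ∞)) :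
    SetValued.entropyAt F ε ≤ (Real.log N : EReal) := by
  have hN' : (0 : ℝ) < N := by exact_mod_cast hN
  have hlim : Tendsto (fun k : ℕ => Real.log N + Real.log k / k + Real.log (C + 1) / k) atTop
      (𝓝 (Real.log N)) := by
    have h1 : Tendsto (fun k : ℕ => Real.log k / k) atTop (𝓝 0) := by
      simpa [Function.comp_def] using (Real.tendsto_pow_log_div_mul_add_atTop 1 0 1 one_ne_zero).comp
        tendsto_natCast_atTop_atTop
    have h2 : Tendsto (fun k : ℕ => Real.log (C + 1) / k) atTop (𝓝 0) :=
      tendsto_const_div_atTop_nhds_zero_nat _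
    simpa using (tendsto_const_nhds.add h1).add h2
  have hlim' := (continuous_coe_real_ereal.tendsto _).comp hlim
  rw [← hlim'.limsup_eq]
  refine limsup_le_limsup ?_
  filter_upwards [eventually_gt_atTop 0] with k hk
  have hk' : (0 : ℝ) < k := by exact_mod_cast hk
  have hb : SetValued.maxSeparated F k ε ≤ ((N ^ k * (k * (C + 1)) : ℕ) : ℕ∞) := by
    refine (h k hk).trans (Nat.cast_le.2 ?_)
    have h1 : N ^ (k - 1) ≤ N ^ k := Nat.pow_le_pow_right hN (Nat.sub_le _ _)
    have h2 : 1 ≤ N ^ k * k := Nat.mul_pos (pow_pos hN k) hk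
    calc k * (N ^ (k - 1) * C) + 1 ≤ k * (N ^ k * C) + N ^ k * k := by gcongr
      _ = N ^ k * (k * (C + 1)) := by ring
  have hne : N ^ k * (k * (C + 1)) ≠ 0 := by positivity
  calc ENNReal.log (SetValued.maxSeparated F k ε : ENNReal) / (k : EReal)
      ≤ (Real.log (N ^ k * (k * (C + 1)) : ℕ) : EReal) / (k : EReal) := by
        refine EReal.div_le_div_right_of_nonneg (by exact_mod_cast Nat.zero_le k) ?_
        rw [← ENNReal.log_toENNReal_natCast hne]
        exact ENNReal.log_monotone (ENat.toENNReal_le.2 hb)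
    _ = ((Real.log (N ^ k * (k * (C + 1)) : ℕ) / k : ℝ) : EReal) := by
        rw [EReal.coe_div, EReal.coe_coe_eq_natCast]
    _ = _ := by
        simp only [Function.comp]
        congr 1
        push_cast
        rw [Real.log_mul (by positivity) (by positivity), Real.log_mul (by positivity)
          (by positivity), Real.log_pow]
        field_simp
        ring

theorem SetValued.le_entropyAt {X : Type*} [MetricSpace X] {F : X → Set X} {ε c : ℝ}
    {K p : ℕ} (hK : 0 < K) (hp : 0 < p) (hc : p * c < Real.log K)
    (h : ∀ j, ((K ^ j : ℕ) : ℕ∞) ≤ SetValued.maxSeparated F (p * j + 1) ε) :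
    (c : EReal) ≤ SetValued.entropyAt F ε := by
  have hp' : (0 : ℝ) < p := by exact_mod_cast hp
  have hev : ∀ᶠ j : ℕ in atTop, c * (p * j + 1) ≤ j * Real.log K := by
    have : Tendsto (fun j : ℕ => (j : ℝ) * (Real.log K - p * c)) atTop atTop :=
      tendsto_natCast_atTop_atTop.atTop_mul_const (sub_pos.2 hc)
    filter_upwards [this.eventually_ge_atTop c] with j hj
    linarith
  have htend : Tendsto (fun j : ℕ => p * j + 1) atTop atTop :=
    tendsto_atTop_mono (fun j => (Nat.le_mul_of_pos_left j hp).trans (Nat.le_succ _)) tendsto_id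
  -- A bound along the lengths `p * j + 1` suffices for a limsup; the strict inequality `hc` absorbs
  -- the extra `1`.
  refine le_limsup_of_frequently_le' (htend.frequently (Eventually.frequently ?_))
  filter_upwards [hev] with j hj
  have hpos : (0 : ℝ) < p * j + 1 := by positivity
  calc (c : EReal) ≤ ((Real.log (K ^ j : ℕ) / (p * j + 1 : ℕ) : ℝ) : EReal) := by
        rw [EReal.coe_le_coe_iff]
        push_cast
        rw [Real.log_pow, le_div_iff₀ hpos]
        exact hj
    _ = (Real.log (K ^ j : ℕ) : EReal) / ((p * j + 1 : ℕ) : EReal) := by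
        rw [EReal.coe_div, EReal.coe_coe_eq_natCast]
    _ ≤ _ := by
        refine EReal.div_le_div_right_of_nonneg (by exact_mod_cast Nat.zero_le _) ?_
        rw [← ENNReal.log_toENNReal_natCast (pow_pos hK j).ne']
        exact ENNReal.log_monotone (ENat.toENNReal_le.2 (h j))

/-! ### Upper bound -/

/-- The preimage of a finite set `s` under `f` has at most `a * #s` points. -/
def AtMostToOne {X : Type*} (a : ℕ) (f : X → X) : Prop :=
  ∀ s : Finset X, ∃ t : Finset X, (t : Set X) = f ⁻¹' s ∧ t.card ≤ a * s.card

theorem AtMostToOne.comp {X : Type*} {a b : ℕ} {f g : X → X} (hf : AtMostToOne a f)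
    (hg : AtMostToOne b g) : AtMostToOne (b * a) (g ∘ f) := by
  intro s
  obtain ⟨t, ht, htc⟩ := hg s
  obtain ⟨u, hu, huc⟩ := hf t
  refine ⟨u, by rw [hu, ht, preimage_comp], huc.trans ?_⟩
  calc a * t.card ≤ a * (b * s.card) := by gcongr
    _ = b * a * s.card := by ring

theorem AtMostToOne.iterate {X : Type*} {a : ℕ} {f : X → X} (hf : AtMostToOne a f) (p : ℕ) :
    AtMostToOne (a ^ p) f^[p] := by
  induction p with
  | zero => exact fun s => ⟨s, rfl, by simp⟩
  | succ p ih =>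
    rw [pow_succ, Function.iterate_succ]
    exact hf.comp ih

theorem AtMostToOne.of_encard_fiber_le {X : Type*} {a : ℕ} {f : X → X}
    (h : ∀ y, (f ⁻¹' {y}).encard ≤ a) : AtMostToOne a f := by
  classical
  have hfin : ∀ y, (f ⁻¹' {y}).Finite := fun y => finite_of_encard_le_coe (h y)
  refine fun s => ⟨s.biUnion fun y => (hfin y).toFinset, by ext; simp, ?_⟩
  rw [mul_comm]
  refine Finset.card_biUnion_le_card_mul _ _ _ fun y _ => ?_
  have := h y
  rw [(hfin y).encard_eq_coe_toFinset_card] at this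
  exact_mod_cast this

/-- A finite set meeting every open interval of length larger than `ε`. -/
theorem unitInterval.exists_finset_between {ε : ℝ} (hε : 0 < ε) :
    ∃ Γ : Finset unitInterval, ∀ u v : unitInterval, u < v → ε < dist u v →
      ∃ w ∈ Γ, u < w ∧ w < v := by
  obtain ⟨t, -, htf, ht⟩ := finite_cover_balls_of_compact
    (isCompact_univ (X := unitInterval)) (half_pos hε)
  refine ⟨htf.toFinset, fun u v huv hd => ?_⟩
  have h1 : (u : ℝ) < v := huv
  have hu := u.2.1
  have hv := v.2.2
  -- A net point within `ε / 2` of the midpoint lies strictly inside an interval longer than `ε`.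
  obtain ⟨w, hw, hmw⟩ := mem_iUnion₂.1 (ht (mem_univ
    (⟨((u : ℝ) + v) / 2, by linarith, by linarith⟩ : unitInterval)))
  rw [Metric.mem_ball, Subtype.dist_eq, Real.dist_eq, abs_lt] at hmw
  rw [Subtype.dist_eq, Real.dist_eq, abs_sub_comm, abs_of_pos (sub_pos.2 h1)] at hd
  refine ⟨w, htf.mem_toFinset.2 hw, Subtype.coe_lt_coe.1 ?_, Subtype.coe_lt_coe.1 ?_⟩ <;>
    simp only at hmw <;> linarith [hmw.1, hmw.2]

theorem encard_le_of_separated {k N : ℕ} {ε : ℝ} {Γ : Finset unitInterval}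
    (hΓ : ∀ u v : unitInterval, u < v → ε < dist u v → ∃ w ∈ Γ, u < w ∧ w < v)
    {φ : Fin k → unitInterval → unitInterval} (hc : ∀ i, Continuous (φ i))
    (hφ : ∀ i, AtMostToOne N (φ i)) {Z : Set unitInterval} (hε : 0 < ε)
    (hZ : Z.Pairwise fun x y => ∃ i, ε < dist (φ i x) (φ i y)) :
    Z.encard ≤ ((k * (N * Γ.card) + 1 : ℕ) : ℕ∞) := by
  classical
  choose t ht htc using fun i => hφ i Γ
  let P : Finset unitInterval := Finset.univ.biUnion t
  have hP : P.card ≤ k * (N * Γ.card) := by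
    simpa using Finset.card_biUnion_le_card_mul Finset.univ t _ fun i _ => htc i
  have hbetween : ∀ x ∈ Z, ∀ y ∈ Z, x < y → ∃ p ∈ P, x < p ∧ p < y := by
    intro x hx y hy hxy
    obtain ⟨i, hi⟩ := hZ hx hy hxy.ne
    have hmem : ∀ p, φ i p ∈ Γ → p ∈ P := fun p hp =>
      Finset.mem_biUnion.2 ⟨i, Finset.mem_univ _, by
        rw [← Finset.mem_coe, ht]; exact hp⟩
    have hne : φ i x ≠ φ i y := fun h => by
      rw [h, dist_self] at hi
      exact hi.not_gt hε
    rcases lt_or_gt_of_ne hne with h | h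
    · obtain ⟨w, hw, h1, h2⟩ := hΓ _ _ h hi
      obtain ⟨p, hp, rfl⟩ := intermediate_value_Ioo hxy.le (hc i).continuousOn ⟨h1, h2⟩
      exact ⟨p, hmem p hw, hp⟩
    · obtain ⟨w, hw, h1, h2⟩ := hΓ _ _ h (dist_comm (φ i x) _ ▸ hi)
      obtain ⟨p, hp, rfl⟩ := intermediate_value_Ioo' hxy.le (hc i).continuousOn ⟨h1, h2⟩
      exact ⟨p, hmem p hw, hp⟩
  have hcount : ∀ x ∈ Z, ∀ y ∈ Z, x < y →
      (P.filter (· < x)).card < (P.filter (· < y)).card := by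
    intro x hx y hy hxy
    obtain ⟨p, hp, h1, h2⟩ := hbetween x hx y hy hxy
    refine Finset.card_lt_card (Finset.ssubset_iff_of_subset ?_ |>.2 ⟨p, ?_, ?_⟩)
    · exact Finset.monotone_filter_right _ fun q _ hq => hq.trans hxy
    · exact Finset.mem_filter.2 ⟨hp, h2⟩
    · exact fun h => (Finset.mem_filter.1 h).2.not_gt h1
  calc Z.encard ≤ ((Finset.range (P.card + 1) : Finset ℕ) : Set ℕ).encard := by
        -- A point of `Z` is determined by how many points of `P` lie below it, a number in `0, …,
        -- #P`.
        refine encard_le_encard_of_injOn (f := fun x => (P.filter (· < x)).card)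
          (fun x _ => ?_) fun x hx y hy hxy => ?_
        · simpa [Nat.lt_succ_iff] using Finset.card_filter_le P (· < x)
        · rcases lt_trichotomy x y with h | h | h
          · exact absurd hxy (hcount x hx y hy h).ne
          · exact h
          · exact absurd hxy (hcount y hy x hx h).ne'
    _ ≤ _ := by
        rw [encard_coe_eq_coe_finsetCard, Finset.card_range]
        exact_mod_cast Nat.succ_le_succ hP

theorem StronglyCommute.entropy_le {n m : ℕ} {f g : unitInterval → unitInterval}
    (h : StronglyCommute f g) (hfc : Continuous f) (hgc : Continuous g)
    (hf : AtMostToOne m f) (hg : AtMostToOne n g) (hn : 0 < n) :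
    SetValued.entropy (SetValued.comp (SetValued.ofMap g) (SetValued.inv f)) ≤
      (Real.log (max n m : ℕ) : EReal) := by
  refine iSup₂_le fun ε hε => ?_
  obtain ⟨Γ, hΓ⟩ := unitInterval.exists_finset_between hε
  refine SetValued.entropyAt_le_log (C := Γ.card) (lt_max_of_lt_left hn) fun k hk => ?_
  refine iSup₂_le fun S hS => ?_
  have hlift : ∀ x, ∃ z, x ∈ S → ∀ i : Fin k, x i = g^[i] (f^[k - 1 - i] z) := fun x => by
    by_cases hx : x ∈ S
    · exact (h.exists_lift_of_mem_orbits hk (hS.1 hx)).imp fun _ hz _ => hz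
    · exact ⟨0, fun h => absurd h hx⟩
  choose z hz using hlift
  have hinj : InjOn z S := fun x hx y hy hxy => funext fun i => by
    rw [hz x hx i, hz y hy i, hxy]
  rw [← hinj.encard_image]
  refine encard_le_of_separated hΓ (φ := fun i : Fin k => g^[i] ∘ f^[k - 1 - i])
    (fun i => (hgc.iterate i).comp (hfc.iterate _)) (fun i s => ?_) hε ?_
  · obtain ⟨t, ht, htc⟩ := (hf.iterate (k - 1 - i)).comp (hg.iterate i) s
    refine ⟨t, ht, htc.trans (Nat.mul_le_mul_right _ ?_)⟩
    calc n ^ (i : ℕ) * m ^ (k - 1 - i) ≤ max n m ^ (i : ℕ) * max n m ^ (k - 1 - i) := by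
          gcongr
          · exact le_max_left _ _
          · exact le_max_right _ _
      _ = max n m ^ (k - 1) := by
          rw [← pow_add]
          congr 1
          omega
  · rintro _ ⟨x, hx, rfl⟩ _ ⟨y, hy, rfl⟩ hxy
    obtain ⟨i, hi⟩ := hS.2 hx hy fun h => hxy (by rw [h])
    refine ⟨i, ?_⟩
    rw [hz x hx i, hz y hy i] at hi
    exact hi

/-! ### Lower bound -/

/-- Uniformly separated right inverses of an iterate of `f` yield exponentially many separated
orbits of `g ∘ f⁻¹`. -/
theorem StronglyCommute.pow_le_maxSeparated {X : Type*} [MetricSpace X] [Nonempty X]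
    {f g : X → X} (h : StronglyCommute f g) {p K : ℕ} {ε : ℝ} (hε : 0 < ε) {r : Fin K → X → X}
    (hr : ∀ i y, f^[p] (r i y) = y) (hsep : ∀ i j, i ≠ j → ∀ y z, ε < dist (r i y) (r j z))
    (j : ℕ) : ((K ^ j : ℕ) : ℕ∞) ≤
      SetValued.maxSeparated (SetValued.comp (SetValued.ofMap g) (SetValued.inv f))
        (p * j + 1) ε := by
  obtain ⟨x₀⟩ := ‹Nonempty X›
  let x : (Fin j → Fin K) → ℕ → X := fun w t => Nat.rec x₀
    (fun t y => if ht : t < j then r (w ⟨t, ht⟩) (g^[p] y) else x₀) t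
  have hxs : ∀ w t (ht : t < j), x w (t + 1) = r (w ⟨t, ht⟩) (g^[p] (x w t)) :=
    fun w t ht => dif_pos ht
  choose z hz using fun w => (h.iterate p).exists_common_lift j (x w) fun t ht => by
    rw [hxs w t ht, hr]
  let o : (Fin j → Fin K) → Fin (p * j + 1) → X := fun w i =>
    g^[i] (f^[p * j + 1 - 1 - i] (z w))
  have hox : ∀ w t (ht : t ≤ j),
      o w ⟨p * t, Nat.lt_succ_of_le (Nat.mul_le_mul_left p ht)⟩ = x w t := by
    intro w t ht
    rw [hz w t ht, ← Function.iterate_mul, ← Function.iterate_mul, Nat.mul_sub]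
    rfl
  have hosep : ∀ w w', (∀ i, ¬ ε < dist (o w i) (o w' i)) → w = w' := by
    intro w w' hww
    -- Words differing in letter `t` would give orbits separated at index `p * (t + 1)`.
    have key : ∀ t ≤ j, x w t = x w' t ∧ ∀ s (hs : s < j), s < t → w ⟨s, hs⟩ = w' ⟨s, hs⟩ := by
      intro t ht
      induction t with
      | zero => exact ⟨rfl, fun s _ hs => absurd hs (Nat.not_lt_zero s)⟩
      | succ t ih =>
        obtain ⟨hx, hw⟩ := ih (Nat.le_of_succ_le ht)
        have hwt : w ⟨t, ht⟩ = w' ⟨t, ht⟩ := by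
          by_contra hne
          refine hww ⟨p * (t + 1), Nat.lt_succ_of_le (Nat.mul_le_mul_left p ht)⟩ ?_
          rw [hox w (t + 1) ht, hox w' (t + 1) ht, hxs w t ht, hxs w' t ht]
          exact hsep _ _ hne _ _
        refine ⟨by rw [hxs w t ht, hxs w' t ht, hx, hwt], fun s hs hst => ?_⟩
        rcases Nat.lt_succ_iff_lt_or_eq.1 hst with h' | rfl
        · exact hw s hs h'
        · exact hwt
    exact funext fun s => (key j le_rfl).2 s s.2 s.2
  have hinj : Function.Injective o := fun w w' hw => hosep w w' fun i => by
    rw [hw, dist_self]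
    exact hε.not_gt
  have hcard : (range o).encard = ((K ^ j : ℕ) : ℕ∞) := by
    rw [← image_univ, hinj.encard_image, encard_univ]
    simp
  rw [← hcard]
  refine le_iSup₂_of_le (range o) ⟨?_, ?_⟩ le_rfl
  · rintro _ ⟨w, rfl⟩
    exact h.mem_orbits _ _
  · rintro _ ⟨w, rfl⟩ _ ⟨w', rfl⟩ hne
    by_contra! hcon
    exact hne (congrArg o (hosep w w' fun i => not_lt.2 (hcon i)))

theorem StronglyCommute.le_entropy {m : ℕ} {f g : unitInterval → unitInterval}
    (h : StronglyCommute f g) (hfc : Continuous f) (hf : HasFullBranches m f) (hm : 0 < m) :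
    (Real.log m : EReal) ≤
      SetValued.entropy (SetValued.comp (SetValued.ofMap g) (SetValued.inv f)) := by
  refine EReal.ge_of_forall_gt_iff_ge.1 fun c hc => ?_
  have hc' : 0 < Real.log m - c := sub_pos.2 (EReal.coe_lt_coe_iff.1 hc)
  -- Discarding half of the branches costs `log 2 / p` in the growth rate, which this `p` makes
  -- smaller than `log m - c`.
  obtain ⟨p, hp⟩ := exists_nat_gt (Real.log 2 / (Real.log m - c))
  rw [div_lt_iff₀ hc'] at hp
  have hp0 : 0 < p := Nat.pos_of_ne_zero fun h0 => by
    rw [h0, Nat.cast_zero, zero_mul] at hp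
    exact hp.not_gt (Real.log_pos one_lt_two)
  obtain ⟨K, ε, r, hK, hε, hr, hsep⟩ := (hf.iterate hfc p).exists_separated_rightInverse
  have hmp : 0 < m ^ p := pow_pos hm p
  have hK0 : 0 < K := by omega
  have hlog : p * Real.log m ≤ Real.log 2 + Real.log K := by
    have hK' : ((m : ℝ) ^ p) ≤ 2 * K := by exact_mod_cast hK
    rw [← Real.log_pow, ← Real.log_mul two_ne_zero (by positivity)]
    exact Real.log_le_log (by positivity) hK'
  exact le_iSup₂_of_le ε hε (SetValued.le_entropyAt hK0 hp0 (by linarith)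
    (h.pow_le_maxSeparated hε hr hsep))

theorem theorem4p20 (n m : ℕ) (hn : 2 ≤ n) (hm : 2 ≤ m)
    (Fn Fm : unitInterval → unitInterval)
    (hFn : IsOpenIntervalMap n Fn) (hFm : IsOpenIntervalMap m Fm)
    (hcomm : SetValued.comp (SetValued.ofMap Fn) (SetValued.inv Fm) =
      SetValued.comp (SetValued.inv Fm) (SetValued.ofMap Fn)) :
    SetValued.entropy (SetValued.comp (SetValued.ofMap Fn) (SetValued.inv Fm)) =
      ((max (Real.log n) (Real.log m) : ℝ) : EReal) := by
  have h := StronglyCommute.of_comp_eq hcomm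
  have hn0 : 0 < n := by omega
  have hm0 : 0 < m := by omega
  have hmax : max (Real.log n) (Real.log m) = Real.log (max n m : ℕ) := by
    have hmono : MonotoneOn Real.log (Ioi 0) := Real.strictMonoOn_log.monotoneOn
    rw [Nat.cast_max]
    exact (hmono.map_max (mem_Ioi.2 (Nat.cast_pos.2 hn0))
      (mem_Ioi.2 (Nat.cast_pos.2 hm0))).symm
  refine le_antisymm ?_ ?_
  · rw [hmax]
    exact h.entropy_le hFm.continuous hFn.continuous (.of_encard_fiber_le hFm.encard_fiber_le)
      (.of_encard_fiber_le hFn.encard_fiber_le) hn0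
  · rcases max_choice (Real.log n) (Real.log m) with hc | hc <;> rw [hc]
    · rw [SetValued.entropy_reverse]
      exact h.symm.le_entropy hFn.continuous hFn.hasFullBranches hn0
    · exact h.le_entropy hFm.continuous hFm.hasFullBranches hm0
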